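/- **Problem.** Consider $\min f(x)=\tfrac12x^THx-c^Tx$ over $\Omega=\{x\in\mathbb R^n: q^Tx=b,\ l\le x\le u\}$, where $H\in\mathbb R^{n\times n}$ is symmetric (not necessarily positive semidefinite), $c,q\in\mathbb R^n$, $b\in\mathbb R$, $l_i\in\mathbb R\cup\{-\infty\}$, $u_i\in\mathbb R\cup\{+\infty\}$ and $l_i<u_i$ for all $i$. Norms are Euclidean unless marked $\|\cdot\|_\infty$, and $P_S$ is the orthogonal projection onto $S$. For $x\in\Omega$ let $\mathcal A_l(x)=\{i:x_i=l_i\}$, $\mathcal A_u(x)=\{i:x_i=u_i\}$, $\mathcal A(x)=\mathcal A_l(x)\cup\mathcal A_u(x)$, $\mathcal F(x)=\{1,\dots,n\}\setminus\mathcal A(x)$; active sets at two points are called equal if both their lower and their upper parts agree. Let $\Omega(x)=\{v: q^Tv=b,\ v_i=x_i\ \forall i\in\mathcal A(x)\}$ and $T_\Omega(x)=\{v: q^Tv=0,\ v_i\ge0\ \forall i\in\mathcal A_l(x),\ v_i\le0\ \forall i\in\mathcal A_u(x)\}$. The projected gradient $\nabla_\Omega f(x)$ is the minimizer of $\|v+\nabla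 f(x)\|$ over $v\in T_\Omega(x)$. The free gradient $\varphi(x)$ has components $\nabla f_i(x)-\rho(x)q_i$ for $i\in\mathcal F(x)$ and $0$ for $i\in\mathcal A(x)$, where $\rho(x)=\sum_{i\in\mathcal F(x)}q_i\nabla f_i(x)\big/\sum_{i\in\mathcal F(x)}q_i^2$ (and $\rho(x)=0$ if $q_i=0$ for all $i\in\mathcal F(x)$); the chopped gradient is $\beta(x)=-\nabla_\Omega f(x)-\varphi(x)$. A point $x\in\Omega$ is stationary if there are $\rho\in\mathbb R$ and $\lambda_i\in\mathbb R$ ($i\in\mathcal A(x)$) with $\nabla f(x)=\sum_{i\in\mathcal A(x)}\lambda_ie_i+\rho q$, $\lambda_i\ge0$ for $i\in\mathcal A_l(x)$ and $\lambda_i\le0$ for $i\in\mathcal A_u(x)$. **Method (P2GP).** Fix $\gamma_1,\gamma_2,\gamma_3,\Gamma>0$, $\mu_1,\mu_2,\eta\in(0,1)$, $tol\ge0$ and $x^0\in\Omega$. Write $f^k=f(x^k)$. The method stops as soon as $\|\varphi(x^k)+\beta(x^k)\|\le tol$. Otherwise it alternates the following two phases, beginning with an identification phase at $k=0$. *Identification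 phase*, started at index $m$. With $v=\nabla_\Omega f(x^k)$: if $v^THv\le0$ and $x^k+\alpha v\in\Omega$ for arbitrarily large $\alpha>0$, the method stops (unboundedness). Otherwise $x^{k+1}=x^k(\alpha^k)$, where $x^k(\alpha)=P_\Omega(x^k-\alpha\nabla f(x^k))$ and $\alpha^k$ satisfies $$f^{k+1}\le f^k+\mu_1\nabla f(x^k)^T(x^{k+1}-x^k),\qquad \alpha^k\le\gamma_1,\qquad \alpha^k\ge\gamma_2\ \text{ or }\ \alpha^k\ge\gamma_3\bar\alpha^k>0,$$ for some $\bar\alpha^k$ with $f(x^k(\bar\alpha^k))>f^k+\mu_2\nabla f(x^k)^T(x^k(\bar\alpha^k)-x^k)$. The phase continues at $k+1$ if $\mathcal A(x^{k+1})\ne\mathcal A(x^k)$ and $f^k-f^{k+1}>\eta\,(f^j-f^{j+1})$ for all $m\le j<k$; otherwise a minimization phase starts at $k+1$. *Minimization phase.* Compute an approximate solution $d$ of $\min\{f(x^k+d): q^Td=0,\ d_i=0\ \forall i\in\mathcal A(x^k)\}$; all that is required of $d$ is that it satisfies these constraints and $\nabla f(x^k)^Td\le0$. If $d^THd\le0$,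 let $\alpha^k$ be the largest $\alpha>0$ with $x^k+\alpha d\in\Omega$; if there is none, the method stops (unboundedness), otherwise $x^{k+1}=x^k+\alpha^kd$ and a new identification phase starts at $k+1$. If $d^THd>0$, then $x^{k+1}=P_{\Omega\cap\Omega(x^k)}(x^k+\alpha^kd)$ with $\alpha^k>0$ such that $f^{k+1}<f^k$; the phase continues at $k+1$ if $\|\beta(x^{k+1})\|_\infty\le\Gamma\|\varphi(x^{k+1})\|$, otherwise a new identification phase starts at $k+1$. Let $K_{GP}$ be the set of those $k$ for which $x^{k+1}$ is computed in an identification phase. **Theorem.** Let $\{x^k\}$ be a sequence generated by the P2GP method and assume that $K_{GP}$ is infinite. If $K\subseteq K_{GP}$ is infinite and the subsequence $\{x^k\}_{k\in K}$ is bounded, then $$\lim_{k\in K,\ k\to\infty}\|\nabla_\Omega f(x^{k+1})\|=0.$$ Moreover, every limit point of $\{x^k\}_{k\in K_{GP}}$ is a stationary point of the problem. -/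

import Mathlib

open Filter Topology
open scoped InnerProductSpace Matrix

/-! ### Orthogonal projections onto closed convex sets -/

/-- `p` is a point of `S` at minimal Euclidean distance from `y`. -/
def IsProj {n : ℕ} (S : Set (EuclideanSpace ℝ (Fin n))) (y p : EuclideanSpace ℝ (Fin n)) : Prop :=
  p ∈ S ∧ ∀ z ∈ S, ‖p - y‖ ≤ ‖z - y‖

/-- The orthogonal projection of `y` onto `S`, for `S` nonempty, closed and convex. It is only
used for such sets, see `isProj_proj` and `IsProj.unique`. -/
noncomputable def proj {n : ℕ} (S : Set (EuclideanSpace ℝ (Fin n)))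
    (y : EuclideanSpace ℝ (Fin n)) : EuclideanSpace ℝ (Fin n) :=
  Classical.epsilon (IsProj S y)

theorem isProj_proj {n : ℕ} {S : Set (EuclideanSpace ℝ (Fin n))} (hne : S.Nonempty)
    (hcl : IsClosed S) (y : EuclideanSpace ℝ (Fin n)) :
    IsProj S y (proj S y) := by
  apply Classical.epsilon_spec (p := IsProj S y)
  obtain ⟨p, hp, h⟩ := hcl.exists_infDist_eq_dist hne y
  refine ⟨p, hp, fun z hz => ?_⟩
  have := Metric.infDist_le_dist_of_mem (x := y) hz
  rw [h, dist_comm, dist_comm y z, dist_eq_norm, dist_eq_norm] at this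
  exact this

theorem IsProj.unique {n : ℕ} {S : Set (EuclideanSpace ℝ (Fin n))} (hconv : Convex ℝ S)
    {y p p' : EuclideanSpace ℝ (Fin n)} (hp : IsProj S y p) (hp' : IsProj S y p') : p = p' := by
  have hmid : (1 / 2 : ℝ) • p + (1 / 2 : ℝ) • p' ∈ S :=
    hconv hp.1 hp'.1 (by norm_num) (by norm_num) (by norm_num)
  have h1 := hp.2 _ hmid
  have heq : ‖p - y‖ = ‖p' - y‖ := le_antisymm (hp.2 _ hp'.1) (hp'.2 _ hp.1)
  have hpar := parallelogram_law_with_norm ℝ (p - y) (p' - y)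
  have hsum : (p - y) + (p' - y) = (2 : ℝ) • ((1 / 2 : ℝ) • p + (1 / 2 : ℝ) • p' - y) := by
    module
  rw [hsum, norm_smul, ← heq, sub_sub_sub_cancel_right, Real.norm_ofNat] at hpar
  have h0 : ‖p - p'‖ * ‖p - p'‖ ≤ 0 := by
    nlinarith [norm_nonneg (p - y)]
  have : ‖p - p'‖ = 0 := by nlinarith [norm_nonneg (p - p')]
  exact sub_eq_zero.mp (norm_eq_zero.mp this)

/-! ### The quadratic problem -/

/-- The data of the problem: minimize `(1/2) xᵀ H x - cᵀ x` subject to `qᵀ x = b` and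
`l ≤ x ≤ u`, where lower bounds may be `-∞`, upper bounds may be `+∞`, and `l i < u i`
(which excludes `l i = +∞` and `u i = -∞`). -/
structure SLBQP (n : ℕ) where
  H : Matrix (Fin n) (Fin n) ℝ
  c : EuclideanSpace ℝ (Fin n)
  q : EuclideanSpace ℝ (Fin n)
  b : ℝ
  l : Fin n → EReal
  u : Fin n → EReal
  symm : H.IsSymm
  l_lt_u : ∀ i, l i < u i

namespace SLBQP

/-- The bilinear form `vᵀ H w`. -/
def form {n : ℕ} (P : SLBQP n) (v w : EuclideanSpace ℝ (Fin n)) : ℝ :=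
  WithLp.ofLp v ⬝ᵥ P.H *ᵥ WithLp.ofLp w

/-- The objective function. -/
noncomputable def f {n : ℕ} (P : SLBQP n) (x : EuclideanSpace ℝ (Fin n)) : ℝ :=
  (1 / 2) * P.form x x - ⟪P.c, x⟫_ℝ

/-- The gradient of the objective function, `H x - c`; see `hasGradientAt_f`. -/
def grad {n : ℕ} (P : SLBQP n) (x : EuclideanSpace ℝ (Fin n)) : EuclideanSpace ℝ (Fin n) :=
  WithLp.toLp 2 (P.H *ᵥ WithLp.ofLp x) - P.c

theorem f_add {n : ℕ} (P : SLBQP n) (x d : EuclideanSpace ℝ (Fin n)) :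
    P.f (x + d) = P.f x + ⟪P.grad x, d⟫_ℝ + (1 / 2) * P.form d d := by
  have hs : WithLp.ofLp x ⬝ᵥ P.H *ᵥ WithLp.ofLp d = WithLp.ofLp d ⬝ᵥ P.H *ᵥ WithLp.ofLp x := by
    rw [Matrix.dotProduct_mulVec, ← Matrix.mulVec_transpose, P.symm.eq, dotProduct_comm]
  have hi : ⟪WithLp.toLp 2 (P.H *ᵥ WithLp.ofLp x), d⟫_ℝ
      = WithLp.ofLp d ⬝ᵥ P.H *ᵥ WithLp.ofLp x := by
    simp [PiLp.inner_apply, dotProduct]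
  simp only [f, form, grad, inner_sub_left, inner_add_right, WithLp.ofLp_add, Matrix.mulVec_add,
    add_dotProduct, dotProduct_add, hs, hi]
  ring

theorem hasGradientAt_f {n : ℕ} (P : SLBQP n) (x : EuclideanSpace ℝ (Fin n)) :
    HasGradientAt P.f (P.grad x) x := by
  rw [hasGradientAt_iff_isLittleO]
  set L := Matrix.toEuclideanCLM (𝕜 := ℝ) P.H with hL
  have hform : ∀ d, P.form d d = ⟪L d, d⟫_ℝ := by
    intro d
    simp [form, hL, PiLp.inner_apply, dotProduct, Matrix.ofLp_toEuclideanCLM]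
  have key : ∀ y, P.f y - P.f x - ⟪P.grad x, y - x⟫_ℝ = (1 / 2) * ⟪L (y - x), y - x⟫_ℝ := by
    intro y
    have := P.f_add x (y - x)
    rw [add_sub_cancel, hform] at this
    linarith
  simp only [key]
  have hO : (fun y => (1 / 2) * ⟪L (y - x), y - x⟫_ℝ) =O[𝓝 x] fun y => ‖y - x‖ ^ 2 := by
    refine Asymptotics.IsBigO.of_bound ((1 / 2) * ‖L‖) (Eventually.of_forall fun y => ?_)
    have h1 := norm_inner_le_norm (𝕜 := ℝ) (L (y - x)) (y - x)
    have h2 := L.le_opNorm (y - x)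
    rw [norm_mul, norm_pow, norm_norm]
    have h3 : ‖L (y - x)‖ * ‖y - x‖ ≤ ‖L‖ * ‖y - x‖ * ‖y - x‖ := by gcongr
    have h4 : ‖(1 / 2 : ℝ)‖ = 1 / 2 := by norm_num
    rw [h4]
    nlinarith
  refine hO.trans_isLittleO ?_
  have := Asymptotics.isLittleO_pow_sub_sub x (m := 2) (by norm_num)
  exact this

/-- The feasible set `Ω`. -/
def feasible {n : ℕ} (P : SLBQP n) : Set (EuclideanSpace ℝ (Fin n)) :=
  {x | ⟪P.q, x⟫_ℝ = P.b ∧ ∀ i, P.l i ≤ (x i : EReal) ∧ (x i : EReal) ≤ P.u i}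

/-- `A_l(x)` -/
def activeLower {n : ℕ} (P : SLBQP n) (x : EuclideanSpace ℝ (Fin n)) : Set (Fin n) :=
  {i | (x i : EReal) = P.l i}

/-- `A_u(x)` -/
def activeUpper {n : ℕ} (P : SLBQP n) (x : EuclideanSpace ℝ (Fin n)) : Set (Fin n) :=
  {i | (x i : EReal) = P.u i}

/-- The active set `A(x)`. -/
def active {n : ℕ} (P : SLBQP n) (x : EuclideanSpace ℝ (Fin n)) : Set (Fin n) :=
  P.activeLower x ∪ P.activeUpper x

/-- Equality of the active sets at two points, lower and upper parts compared separately. -/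
def SameActive {n : ℕ} (P : SLBQP n) (x y : EuclideanSpace ℝ (Fin n)) : Prop :=
  P.activeLower x = P.activeLower y ∧ P.activeUpper x = P.activeUpper y

/-- The affine closure `Ω(x)` of the face determined by the active set at `x`. -/
def face {n : ℕ} (P : SLBQP n) (x : EuclideanSpace ℝ (Fin n)) :
    Set (EuclideanSpace ℝ (Fin n)) :=
  {v | ⟪P.q, v⟫_ℝ = P.b ∧ ∀ i ∈ P.active x, v i = x i}

/-- Stationary points: feasible points at which Lagrange multipliers exist. -/
def IsStationary {n : ℕ} (P : SLBQP n) (x : EuclideanSpace ℝ (Fin n)) : Prop :=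
  x ∈ P.feasible ∧ ∃ (ρ : ℝ) (lam : Fin n → ℝ),
    (∀ i, P.grad x i = lam i + ρ * P.q i) ∧
    (∀ i, i ∉ P.active x → lam i = 0) ∧
    (∀ i ∈ P.activeLower x, 0 ≤ lam i) ∧
    (∀ i ∈ P.activeUpper x, lam i ≤ 0)

/-- The tangent cone `T_Ω(x)`. -/
def tangent {n : ℕ} (P : SLBQP n) (x : EuclideanSpace ℝ (Fin n)) :
    Set (EuclideanSpace ℝ (Fin n)) :=
  {v | ⟪P.q, v⟫_ℝ = 0 ∧ (∀ i ∈ P.activeLower x, 0 ≤ v i) ∧ (∀ i ∈ P.activeUpper x, v i ≤ 0)}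

/-- The projected gradient: the minimizer of `‖v + ∇f(x)‖` over the tangent cone. -/
noncomputable def projGrad {n : ℕ} (P : SLBQP n) (x : EuclideanSpace ℝ (Fin n)) :
    EuclideanSpace ℝ (Fin n) :=
  proj (P.tangent x) (-P.grad x)

theorem isClosed_feasible {n : ℕ} (P : SLBQP n) : IsClosed P.feasible := by
  have h : P.feasible = {x | ⟪P.q, x⟫_ℝ = P.b} ∩
      ⋂ i, ({x : EuclideanSpace ℝ (Fin n) | P.l i ≤ (x i : EReal)} ∩
        {x | (x i : EReal) ≤ P.u i}) := by
    ext x; simp [feasible]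
  rw [h]
  have hc : ∀ i, Continuous fun x : EuclideanSpace ℝ (Fin n) => (x i : EReal) := fun i =>
    continuous_coe_real_ereal.comp (by fun_prop)
  exact (isClosed_eq (by fun_prop) (by fun_prop)).inter (isClosed_iInter fun i =>
    (isClosed_le continuous_const (hc i)).inter (isClosed_le (hc i) continuous_const))

theorem convex_feasible {n : ℕ} (P : SLBQP n) : Convex ℝ P.feasible := by
  have h : P.feasible = {x | ⟪P.q, x⟫_ℝ = P.b} ∩
      ⋂ i, ((fun x : EuclideanSpace ℝ (Fin n) => x i) ⁻¹'
        {t : ℝ | P.l i ≤ (t : EReal) ∧ (t : EReal) ≤ P.u i}) := by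
    ext x; simp [feasible]
  rw [h]
  refine Convex.inter (convex_hyperplane (f := fun x => ⟪P.q, x⟫_ℝ)
    ⟨fun x y => inner_add_right _ _ _, fun a x => real_inner_smul_right _ _ _⟩ _)
    (convex_iInter fun i => Convex.is_linear_preimage ?_
      (f := fun x : EuclideanSpace ℝ (Fin n) => x i) ⟨fun x y => rfl, fun a x => rfl⟩)
  have : Set.OrdConnected {t : ℝ | P.l i ≤ (t : EReal) ∧ (t : EReal) ≤ P.u i} :=
    ⟨fun s hs t ht r hr => ⟨hs.1.trans (EReal.coe_le_coe_iff.2 hr.1),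
      (EReal.coe_le_coe_iff.2 hr.2).trans ht.2⟩⟩
  exact this.convex

theorem zero_mem_tangent {n : ℕ} (P : SLBQP n) (x : EuclideanSpace ℝ (Fin n)) :
    0 ∈ P.tangent x := by
  simp [tangent]

theorem isClosed_tangent {n : ℕ} (P : SLBQP n) (x : EuclideanSpace ℝ (Fin n)) :
    IsClosed (P.tangent x) := by
  have h : P.tangent x = {v | ⟪P.q, v⟫_ℝ = 0} ∩
      ((⋂ i ∈ P.activeLower x, {v : EuclideanSpace ℝ (Fin n) | 0 ≤ v i}) ∩
        ⋂ i ∈ P.activeUpper x, {v : EuclideanSpace ℝ (Fin n) | v i ≤ 0}) := by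
    ext v; simp [tangent]
  rw [h]
  exact (isClosed_eq (by fun_prop) (by fun_prop)).inter
    ((isClosed_biInter fun i _ => isClosed_le (by fun_prop) (by fun_prop)).inter
      (isClosed_biInter fun i _ => isClosed_le (by fun_prop) (by fun_prop)))

theorem convex_tangent {n : ℕ} (P : SLBQP n) (x : EuclideanSpace ℝ (Fin n)) :
    Convex ℝ (P.tangent x) := by
  rintro v ⟨hv, hv1, hv2⟩ w ⟨hw, hw1, hw2⟩ a b ha hb _
  refine ⟨by simp [inner_add_right, real_inner_smul_right, hv, hw], fun i hi => ?_, fun i hi => ?_⟩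
  · have h1 := mul_nonneg ha (hv1 i hi)
    have h2 := mul_nonneg hb (hw1 i hi)
    simpa using add_nonneg h1 h2
  · have h1 := mul_nonpos_of_nonneg_of_nonpos ha (hv2 i hi)
    have h2 := mul_nonpos_of_nonneg_of_nonpos hb (hw2 i hi)
    simpa using add_nonpos h1 h2

open scoped Classical in
/-- The multiplier estimate `ρ(x)`; sums run over the free indices. -/
noncomputable def rho {n : ℕ} (P : SLBQP n) (x : EuclideanSpace ℝ (Fin n)) : ℝ :=
  if ∀ i, i ∉ P.active x → P.q i = 0 then 0
  else (∑ i with i ∉ P.active x, P.q i * P.grad x i) / ∑ i with i ∉ P.active x, P.q i * P.q i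

open scoped Classical in
/-- The free gradient `φ(x)`. -/
noncomputable def freeGrad {n : ℕ} (P : SLBQP n) (x : EuclideanSpace ℝ (Fin n)) :
    EuclideanSpace ℝ (Fin n) :=
  WithLp.toLp 2 fun i => if i ∈ P.active x then 0 else P.grad x i - P.rho x * P.q i

/-- The chopped gradient `β(x)`. -/
noncomputable def choppedGrad {n : ℕ} (P : SLBQP n) (x : EuclideanSpace ℝ (Fin n)) :
    EuclideanSpace ℝ (Fin n) :=
  -P.projGrad x - P.freeGrad x

/-- The positive steplengths that keep `x + α d` feasible. -/
def feasibleSteps {n : ℕ} (P : SLBQP n) (x d : EuclideanSpace ℝ (Fin n)) : Set ℝ :=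
  {α | 0 < α ∧ x + α • d ∈ P.feasible}

/-- The gradient projection arc `x(α) = P_Ω(x - α ∇f(x))`. -/
noncomputable def arc {n : ℕ} (P : SLBQP n) (x : EuclideanSpace ℝ (Fin n)) (α : ℝ) :
    EuclideanSpace ℝ (Fin n) :=
  proj P.feasible (x - α • P.grad x)

end SLBQP

/-! ### The P2GP method -/

/-- The parameters of the method. -/
structure P2GPParams where
  γ₁ : ℝ
  γ₂ : ℝ
  γ₃ : ℝ
  μ₁ : ℝ
  μ₂ : ℝ
  tol : ℝ
  η : ℝ
  Γ : ℝ
  γ₁_pos : 0 < γ₁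
  γ₂_pos : 0 < γ₂
  γ₃_pos : 0 < γ₃
  μ₁_mem : μ₁ ∈ Set.Ioo (0 : ℝ) 1
  μ₂_mem : μ₂ ∈ Set.Ioo (0 : ℝ) 1
  tol_nonneg : 0 ≤ tol
  η_mem : η ∈ Set.Ioo (0 : ℝ) 1
  Γ_pos : 0 < Γ

namespace SLBQP

/-- The sufficient decrease conditions on the steplength `α` of a gradient projection step. -/
def SufficientDecrease {n : ℕ} (P : SLBQP n) (p : P2GPParams) (x : EuclideanSpace ℝ (Fin n))
    (α : ℝ) : Prop :=
  P.f (P.arc x α) ≤ P.f x + p.μ₁ * ⟪P.grad x, P.arc x α - x⟫_ℝ ∧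
  α ≤ p.γ₁ ∧
  (p.γ₂ ≤ α ∨ ∃ αbar : ℝ, p.γ₃ * αbar ≤ α ∧ 0 < p.γ₃ * αbar ∧
    P.f x + p.μ₂ * ⟪P.grad x, P.arc x αbar - x⟫_ℝ < P.f (P.arc x αbar))

/-- The stopping test of the method. -/
def Converged {n : ℕ} (P : SLBQP n) (p : P2GPParams) (x : EuclideanSpace ℝ (Fin n)) : Prop :=
  ‖P.freeGrad x + P.choppedGrad x‖ ≤ p.tol

/-- The test by which an identification phase discovers unboundedness: nonpositive curvature along
the projected gradient, and arbitrarily long feasible steps along it. -/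
def DetectsUnbounded {n : ℕ} (P : SLBQP n) (x : EuclideanSpace ℝ (Fin n)) : Prop :=
  P.form (P.projGrad x) (P.projGrad x) ≤ 0 ∧ ¬ BddAbove (P.feasibleSteps x (P.projGrad x))

/-- The proportionality test; on the left is the maximum norm. -/
def Proportional {n : ℕ} (P : SLBQP n) (p : P2GPParams) (x : EuclideanSpace ℝ (Fin n)) : Prop :=
  ‖(WithLp.ofLp (P.choppedGrad x) : Fin n → ℝ)‖ ≤ p.Γ * ‖P.freeGrad x‖

/-- What is required of the approximate solution `d` of the reduced problem
`min f(x + d)` subject to `qᵀ d = 0` and `d i = 0` for active `i`: it is feasible, and it is not an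
ascent direction for `f` at `x`. -/
def IsReducedDirection {n : ℕ} (P : SLBQP n) (x d : EuclideanSpace ℝ (Fin n)) : Prop :=
  ⟪P.q, d⟫_ℝ = 0 ∧ (∀ i ∈ P.active x, d i = 0) ∧ ⟪P.grad x, d⟫_ℝ ≤ 0

end SLBQP

/-- The two phases of the method. -/
inductive P2GPPhase where
  | identification
  | minimization

/-- A nonterminating run of the method. Here `x k` is the `k`-th iterate, `phase k` is the phase in
which `x (k + 1)` is computed from `x k`, and `m k` is the index at which the last identification
phase begun so far has started. -/
structure P2GPRun {n : ℕ} (P : SLBQP n) (p : P2GPParams) where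
  x : ℕ → EuclideanSpace ℝ (Fin n)
  phase : ℕ → P2GPPhase
  m : ℕ → ℕ
  x_zero : x 0 ∈ P.feasible
  phase_zero : phase 0 = .identification
  m_zero : m 0 = 0
  /-- the run does not stop by convergence -/
  not_converged : ∀ k, ¬ P.Converged p (x k)
  /-- the run does not stop by unboundedness in an identification phase -/
  not_unbounded : ∀ k, phase k = .identification → ¬ P.DetectsUnbounded (x k)
  /-- gradient projection step -/
  identification_step : ∀ k, phase k = .identification →
    ∃ α : ℝ, P.SufficientDecrease p (x k) α ∧ x (k + 1) = P.arc (x k) α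
  /-- the identification phase goes on as long as the active set changes and the decrease of `f`
  exceeds `η` times all earlier ones of this phase -/
  identification_continue : ∀ k, phase k = .identification →
    (¬ P.SameActive (x (k + 1)) (x k) ∧
      ∀ j, m k ≤ j → j < k →
        p.η * (P.f (x j) - P.f (x (j + 1))) < P.f (x k) - P.f (x (k + 1))) →
    phase (k + 1) = .identification ∧ m (k + 1) = m k
  identification_stop : ∀ k, phase k = .identification →
    ¬ (¬ P.SameActive (x (k + 1)) (x k) ∧
      ∀ j, m k ≤ j → j < k →
        p.η * (P.f (x j) - P.f (x (j + 1))) < P.f (x k) - P.f (x (k + 1))) →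
    phase (k + 1) = .minimization ∧ m (k + 1) = m k
  /-- A minimization step computes a direction `d`. If its curvature is nonpositive, the longest
  feasible step along `d` is taken (the run would stop if there were none) and a new identification
  phase begins. Otherwise a projected step that decreases `f` is taken within the current face, and
  the phase goes on if and only if the new iterate is proportional. -/
  minimization_step : ∀ k, phase k = .minimization →
    ∃ d, P.IsReducedDirection (x k) d ∧
      ((P.form d d ≤ 0 ∧
          (∃ α : ℝ, IsGreatest (P.feasibleSteps (x k) d) α ∧ x (k + 1) = x k + α • d) ∧
          phase (k + 1) = .identification ∧ m (k + 1) = k + 1) ∨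
        (0 < P.form d d ∧
          (∃ α : ℝ, 0 < α ∧ x (k + 1) = proj (P.feasible ∩ P.face (x k)) (x k + α • d)) ∧
          P.f (x (k + 1)) < P.f (x k) ∧
          (P.Proportional p (x (k + 1)) → phase (k + 1) = .minimization ∧ m (k + 1) = m k) ∧
          (¬ P.Proportional p (x (k + 1)) →
            phase (k + 1) = .identification ∧ m (k + 1) = k + 1)))

/-- The set `K_GP` of gradient projection iterations of a run. -/
def P2GPRun.gpIterations {n : ℕ} {P : SLBQP n} {p : P2GPParams} (r : P2GPRun P p) : Set ℕ :=
  {k | r.phase k = .identification}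

/-! ### Projections -/

theorem IsProj.inner_le_zero {n : ℕ} {S : Set (EuclideanSpace ℝ (Fin n))} (hconv : Convex ℝ S)
    {y p z : EuclideanSpace ℝ (Fin n)} (hp : IsProj S y p) (hz : z ∈ S) :
    ⟪y - p, z - p⟫_ℝ ≤ 0 := by
  have hmin : ‖y - p‖ = ⨅ w : S, ‖y - w‖ := by
    have : Nonempty S := ⟨⟨p, hp.1⟩⟩
    refine le_antisymm (le_ciInf fun w => ?_) (ciInf_le ⟨0, ?_⟩ (⟨p, hp.1⟩ : S))
    · rw [norm_sub_rev, norm_sub_rev y]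
      exact hp.2 w w.2
    · rintro _ ⟨w, rfl⟩
      exact norm_nonneg _
  exact (norm_eq_iInf_iff_real_inner_le_zero hconv hp.1).1 hmin z hz

namespace SLBQP

variable {n : ℕ} (P : SLBQP n)

/-! ### The objective function -/

/-- The continuous linear map `v ↦ H v`. -/
noncomputable def hessian : EuclideanSpace ℝ (Fin n) →L[ℝ] EuclideanSpace ℝ (Fin n) :=
  Matrix.toEuclideanCLM (𝕜 := ℝ) P.H

theorem form_eq_inner (d : EuclideanSpace ℝ (Fin n)) : P.form d d = ⟪P.hessian d, d⟫_ℝ := by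
  simp [form, hessian, PiLp.inner_apply, dotProduct, Matrix.ofLp_toEuclideanCLM]

theorem form_le (d : EuclideanSpace ℝ (Fin n)) : P.form d d ≤ ‖P.hessian‖ * ‖d‖ ^ 2 := by
  rw [form_eq_inner]
  calc ⟪P.hessian d, d⟫_ℝ ≤ ‖P.hessian d‖ * ‖d‖ := real_inner_le_norm _ _
    _ ≤ ‖P.hessian‖ * ‖d‖ * ‖d‖ := by gcongr; exact P.hessian.le_opNorm d
    _ = ‖P.hessian‖ * ‖d‖ ^ 2 := by ring

theorem grad_eq (x : EuclideanSpace ℝ (Fin n)) : P.grad x = P.hessian x - P.c := rfl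

theorem norm_grad_sub_le (x y : EuclideanSpace ℝ (Fin n)) :
    ‖P.grad x - P.grad y‖ ≤ ‖P.hessian‖ * ‖x - y‖ := by
  rw [grad_eq, grad_eq, sub_sub_sub_cancel_right, ← map_sub]
  exact P.hessian.le_opNorm _

theorem continuous_grad : Continuous P.grad :=
  P.hessian.continuous.sub continuous_const

theorem continuous_f : Continuous P.f :=
  continuous_iff_continuousAt.2 fun x => (P.hasGradientAt_f x).differentiableAt.continuousAt

/-! ### The gradient projection arc -/

theorem isProj_arc {x : EuclideanSpace ℝ (Fin n)} (hx : x ∈ P.feasible) (α : ℝ) :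
    IsProj P.feasible (x - α • P.grad x) (P.arc x α) :=
  isProj_proj ⟨x, hx⟩ P.isClosed_feasible _

theorem neg_inner_grad_le {x z : EuclideanSpace ℝ (Fin n)} (hx : x ∈ P.feasible)
    (hz : z ∈ P.feasible) {α : ℝ} (hα : 0 < α) :
    -⟪P.grad x, z - P.arc x α⟫_ℝ ≤ α⁻¹ * ⟪P.arc x α - x, z - P.arc x α⟫_ℝ := by
  have h := (P.isProj_arc hx α).inner_le_zero P.convex_feasible hz
  have heq : x - α • P.grad x - P.arc x α = -(P.arc x α - x) - α • P.grad x := by abel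
  rw [heq, inner_sub_left, inner_neg_left, real_inner_smul_left] at h
  rw [le_inv_mul_iff₀ hα]
  linarith

theorem inner_grad_arc_sub_le {x : EuclideanSpace ℝ (Fin n)} (hx : x ∈ P.feasible) {α : ℝ}
    (hα : 0 < α) : ⟪P.grad x, P.arc x α - x⟫_ℝ ≤ -(α⁻¹ * ‖P.arc x α - x‖ ^ 2) := by
  have h := P.neg_inner_grad_le hx hx hα
  rw [← neg_sub (P.arc x α) x, inner_neg_right, inner_neg_right, real_inner_self_eq_norm_sq] at h
  linarith

/-- A step failing the sufficient decrease test cannot be short, because the gradient is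
Lipschitz continuous. -/
theorem le_of_not_sufficientDecrease {x : EuclideanSpace ℝ (Fin n)} (hx : x ∈ P.feasible)
    {μ α : ℝ} (hμ : μ < 1) (hα : 0 < α)
    (h : P.f x + μ * ⟪P.grad x, P.arc x α - x⟫_ℝ < P.f (P.arc x α)) :
    2 * (1 - μ) / (‖P.hessian‖ + 1) ≤ α := by
  have hf := P.f_add x (P.arc x α - x)
  rw [add_sub_cancel] at hf
  have hform := P.form_le (P.arc x α - x)
  have hin := P.inner_grad_arc_sub_le hx hα
  have hL := norm_nonneg P.hessian
  set s := ‖P.arc x α - x‖ ^ 2 with hs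
  have hs0 : 0 ≤ s := sq_nonneg _
  have h1 : (1 - μ) * (α⁻¹ * s) < 1 / 2 * (‖P.hessian‖ * s) := by
    nlinarith [mul_le_mul_of_nonneg_left hin (sub_nonneg.2 hμ.le)]
  have hspos : 0 < s := by
    rcases hs0.eq_or_lt with h0 | h0
    · rw [← h0] at h1
      simp at h1
    · exact h0
  have h2 : (1 - μ) * α⁻¹ < 1 / 2 * ‖P.hessian‖ := by
    refine lt_of_mul_lt_mul_right ?_ hs0
    linarith
  rw [← div_eq_mul_inv, div_lt_iff₀ hα] at h2
  rw [div_le_iff₀ (by linarith)]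
  nlinarith

theorem exists_steplength_lower_bound (p : P2GPParams) :
    ∃ a > 0, ∀ x ∈ P.feasible, ∀ α, P.SufficientDecrease p x α → a ≤ α := by
  have hμ := p.μ₂_mem.2
  have hL := norm_nonneg P.hessian
  refine ⟨min p.γ₂ (p.γ₃ * (2 * (1 - p.μ₂) / (‖P.hessian‖ + 1))),
    lt_min p.γ₂_pos (mul_pos p.γ₃_pos (div_pos (by linarith) (by linarith))), ?_⟩
  rintro x hx α ⟨-, -, h | ⟨αbar, h1, h2, h3⟩⟩
  · exact (min_le_left _ _).trans h
  · have hpos : 0 < αbar := (mul_pos_iff_of_pos_left p.γ₃_pos).1 h2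
    exact ((min_le_right _ _).trans (mul_le_mul_of_nonneg_left
      (P.le_of_not_sufficientDecrease hx hμ hpos h3) p.γ₃_pos.le)).trans h1

/-- The decrease of `f` achieved by a gradient projection step. -/
theorem SufficientDecrease.sq_norm_le {P : SLBQP n} {p : P2GPParams}
    {x : EuclideanSpace ℝ (Fin n)} (hx : x ∈ P.feasible) {α : ℝ} (hα : 0 < α)
    (h : P.SufficientDecrease p x α) :
    ‖P.arc x α - x‖ ^ 2 ≤ p.γ₁ / p.μ₁ * (P.f x - P.f (P.arc x α)) := by
  obtain ⟨h1, h2, -⟩ := h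
  have hin := P.inner_grad_arc_sub_le hx hα
  have hμ := p.μ₁_mem.1
  have h3 : p.μ₁ * (α⁻¹ * ‖P.arc x α - x‖ ^ 2) ≤ P.f x - P.f (P.arc x α) := by
    nlinarith [mul_le_mul_of_nonneg_left hin hμ.le]
  have h4 : p.γ₁⁻¹ * ‖P.arc x α - x‖ ^ 2 ≤ α⁻¹ * ‖P.arc x α - x‖ ^ 2 := by gcongr
  have h5 := (mul_le_mul_of_nonneg_left h4 hμ.le).trans h3
  have hγ := p.γ₁_pos
  rw [div_mul_eq_mul_div, le_div_iff₀ hμ]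
  calc ‖P.arc x α - x‖ ^ 2 * p.μ₁ = p.γ₁ * (p.μ₁ * (p.γ₁⁻¹ * ‖P.arc x α - x‖ ^ 2)) := by
        field_simp
    _ ≤ _ := mul_le_mul_of_nonneg_left h5 hγ.le

/-! ### Tangent directions and stationarity -/

theorem eventually_add_smul_mem_feasible {x v : EuclideanSpace ℝ (Fin n)} (hx : x ∈ P.feasible)
    (hv : v ∈ P.tangent x) : ∀ᶠ t : ℝ in 𝓝[>] 0, x + t • v ∈ P.feasible := by
  obtain ⟨hq, hl, hu⟩ := hv
  have hlim : ∀ i, Tendsto (fun t : ℝ => ((x i + t * v i : ℝ) : EReal)) (𝓝[>] 0)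
      (𝓝 (x i : EReal)) := by
    intro i
    have hc : Continuous fun t : ℝ => ((x i + t * v i : ℝ) : EReal) :=
      continuous_coe_real_ereal.comp (by fun_prop)
    have := hc.tendsto 0
    simp only [zero_mul, add_zero] at this
    exact this.mono_left nhdsWithin_le_nhds
  have key : ∀ i, ∀ᶠ t : ℝ in 𝓝[>] 0, P.l i ≤ ((x i + t * v i : ℝ) : EReal) ∧
      ((x i + t * v i : ℝ) : EReal) ≤ P.u i := by
    refine fun i => Filter.Eventually.and ?_ ?_
    · rcases (hx.2 i).1.eq_or_lt with h | h
      · filter_upwards [self_mem_nhdsWithin] with t ht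
        rw [h]
        exact EReal.coe_le_coe_iff.2
          (le_add_of_nonneg_right (mul_nonneg (le_of_lt ht) (hl i h.symm)))
      · exact ((hlim i).eventually_const_lt h).mono fun t ht => ht.le
    · rcases (hx.2 i).2.eq_or_lt with h | h
      · filter_upwards [self_mem_nhdsWithin] with t ht
        rw [← h]
        exact EReal.coe_le_coe_iff.2
          (add_le_of_nonpos_right (mul_nonpos_of_nonneg_of_nonpos (le_of_lt ht) (hu i h)))
      · exact ((hlim i).eventually_lt_const h).mono fun t ht => ht.le
  filter_upwards [eventually_all.2 key] with t ht
  exact ⟨by rw [inner_add_right, real_inner_smul_right, hq, hx.1]; ring,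
    fun i => by simpa using ht i⟩

theorem exists_add_smul_mem_feasible {x v : EuclideanSpace ℝ (Fin n)} (hx : x ∈ P.feasible)
    (hv : v ∈ P.tangent x) : ∃ t > (0 : ℝ), x + t • v ∈ P.feasible :=
  ((P.eventually_add_smul_mem_feasible hx hv).and self_mem_nhdsWithin).exists.imp
    fun _ h => ⟨h.2, h.1⟩

theorem isProj_projGrad (x : EuclideanSpace ℝ (Fin n)) :
    IsProj (P.tangent x) (-P.grad x) (P.projGrad x) :=
  isProj_proj ⟨0, P.zero_mem_tangent x⟩ (P.isClosed_tangent x) _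

theorem sq_norm_projGrad_le (x : EuclideanSpace ℝ (Fin n)) :
    ‖P.projGrad x‖ ^ 2 ≤ -⟪P.grad x, P.projGrad x⟫_ℝ := by
  have h := (P.isProj_projGrad x).inner_le_zero (P.convex_tangent x) (P.zero_mem_tangent x)
  rw [zero_sub, inner_neg_right, inner_sub_left, inner_neg_left, real_inner_self_eq_norm_sq] at h
  linarith

theorem norm_projGrad_arc_le {x : EuclideanSpace ℝ (Fin n)} (hx : x ∈ P.feasible) {a α : ℝ}
    (ha : 0 < a) (hα : a ≤ α) :
    ‖P.projGrad (P.arc x α)‖ ≤ (a⁻¹ + ‖P.hessian‖) * ‖P.arc x α - x‖ := by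
  have hα0 : 0 < α := ha.trans_le hα
  set y := P.arc x α with hy
  set v := P.projGrad y with hv
  have hyf : y ∈ P.feasible := (P.isProj_arc hx α).1
  obtain ⟨t, ht, hz⟩ := P.exists_add_smul_mem_feasible hyf (P.isProj_projGrad y).1
  have h1 := P.neg_inner_grad_le hx hz hα0
  rw [← hy, ← hv, add_sub_cancel_left, real_inner_smul_right, real_inner_smul_right] at h1
  have h2 : -⟪P.grad x, v⟫_ℝ ≤ α⁻¹ * ⟪y - x, v⟫_ℝ := by
    refine le_of_mul_le_mul_left ?_ ht
    linarith
  have h3 : α⁻¹ * ⟪y - x, v⟫_ℝ ≤ a⁻¹ * (‖y - x‖ * ‖v‖) :=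
    calc α⁻¹ * ⟪y - x, v⟫_ℝ ≤ α⁻¹ * (‖y - x‖ * ‖v‖) := by
          gcongr
          exact real_inner_le_norm _ _
      _ ≤ _ := by gcongr
  have h4 : -⟪P.grad y - P.grad x, v⟫_ℝ ≤ ‖P.hessian‖ * ‖y - x‖ * ‖v‖ :=
    calc -⟪P.grad y - P.grad x, v⟫_ℝ ≤ ‖P.grad y - P.grad x‖ * ‖v‖ :=
          (neg_le_abs _).trans (abs_real_inner_le_norm _ _)
      _ ≤ _ := by gcongr; exact P.norm_grad_sub_le y x
  have h5 := P.sq_norm_projGrad_le y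
  rw [inner_sub_left] at h4
  by_contra! hlt
  have hvpos : 0 < ‖v‖ := lt_of_le_of_lt (by positivity) hlt
  nlinarith [mul_lt_mul_of_pos_right hlt hvpos]

end SLBQP

theorem exists_between_of_finite {A B : Set ℝ} (hA : A.Finite) (hB : B.Finite)
    (h : ∀ a ∈ A, ∀ b ∈ B, a ≤ b) : ∃ r, (∀ a ∈ A, a ≤ r) ∧ ∀ b ∈ B, r ≤ b := by
  rcases A.eq_empty_or_nonempty with rfl | hne
  · obtain ⟨r, hr⟩ := hB.bddBelow
    exact ⟨r, by simp, fun b hb => hr hb⟩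
  · exact ⟨sSup A, fun a ha => le_csSup hA.bddAbove ha,
      fun b hb => csSup_le hne fun a ha => h a ha b hb⟩

/-- A homogeneous system of one-variable inequalities `ρ c ≤ a` is solvable as soon as every
nonnegative combination of two of them is consistent. -/
theorem exists_forall_mul_le {ι : Type*} [Finite ι] (a c : ι → ℝ)
    (h : ∀ i j s t, 0 ≤ s → 0 ≤ t → s * c i + t * c j = 0 → 0 ≤ s * a i + t * a j) :
    ∃ ρ : ℝ, ∀ i, ρ * c i ≤ a i := by
  obtain ⟨ρ, h1, h2⟩ := exists_between_of_finite
    (A := (fun i => a i / c i) '' {i | c i < 0}) (B := (fun i => a i / c i) '' {i | 0 < c i})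
    (Set.toFinite _) (Set.toFinite _) (by
      rintro _ ⟨i, hi, rfl⟩ _ ⟨j, hj, rfl⟩
      have hi' : c i < 0 := hi
      have hj' : 0 < c j := hj
      have := h i j (c j) (-c i) hj'.le (by linarith) (by ring)
      change a i / c i ≤ a j / c j
      rw [le_div_iff₀ hj', div_mul_eq_mul_div, div_le_iff_of_neg hi']
      linarith)
  refine ⟨ρ, fun i => ?_⟩
  rcases lt_trichotomy (c i) 0 with hc | hc | hc
  · exact (div_le_iff_of_neg hc).1 (h1 _ ⟨i, hc, rfl⟩)
  · have := h i i 1 0 (by norm_num) le_rfl (by simp [hc])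
    rw [hc]
    linarith
  · exact (le_div_iff₀ hc).1 (h2 _ ⟨i, hc, rfl⟩)

namespace SLBQP

variable {n : ℕ} (P : SLBQP n)

theorem not_mem_activeUpper {x : EuclideanSpace ℝ (Fin n)} {i : Fin n}
    (hi : i ∈ P.activeLower x) : i ∉ P.activeUpper x := fun hu =>
  (P.l_lt_u i).ne (hi.symm.trans hu)

/-- Lagrange multipliers exist wherever no tangent direction is a descent direction. -/
theorem isStationary_of_tangent {x : EuclideanSpace ℝ (Fin n)} (hx : x ∈ P.feasible)
    (h : ∀ v ∈ P.tangent x, 0 ≤ ⟪P.grad x, v⟫_ℝ) : P.IsStationary x := by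
  classical
  -- The signed coordinate directions `σ eᵢ` that are admissible at `x`.
  let ι := {e : Fin n × ℝ // (e.2 = 1 ∧ e.1 ∉ P.activeUpper x) ∨
    (e.2 = -1 ∧ e.1 ∉ P.activeLower x)}
  have : Finite ι := by
    refine Set.Finite.to_subtype (Set.Finite.subset
      ((Set.finite_univ (α := Fin n)).prod (Set.toFinite ({1, -1} : Set ℝ))) ?_)
    rintro ⟨i, s⟩ (⟨hs, -⟩ | ⟨hs, -⟩) <;> exact ⟨trivial, by simp_all⟩
  have hdir : ∀ e : ι, (∀ i ∈ P.activeLower x,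
        0 ≤ (EuclideanSpace.single e.1.1 e.1.2 : EuclideanSpace ℝ (Fin n)) i) ∧
      ∀ i ∈ P.activeUpper x,
        (EuclideanSpace.single e.1.1 e.1.2 : EuclideanSpace ℝ (Fin n)) i ≤ 0 := by
    rintro ⟨⟨j, s⟩, (⟨hs, hj⟩ | ⟨hs, hj⟩)⟩ <;> dsimp only at hs hj ⊢ <;> subst hs <;>
      refine ⟨fun i hi => ?_, fun i hi => ?_⟩ <;> rcases eq_or_ne i j with rfl | hij <;>
      simp_all
  obtain ⟨ρ, hρ⟩ := exists_forall_mul_le (ι := ι) (fun e => e.1.2 * P.grad x e.1.1)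
    (fun e => e.1.2 * P.q e.1.1) (by
      intro e e' s t hs ht h0
      have hin : ∀ w : EuclideanSpace ℝ (Fin n),
          ⟪w, s • EuclideanSpace.single e.1.1 e.1.2 + t • EuclideanSpace.single e'.1.1 e'.1.2⟫_ℝ
            = s * (e.1.2 * w e.1.1) + t * (e'.1.2 * w e'.1.1) := by
        intro w
        rw [inner_add_right, real_inner_smul_right, real_inner_smul_right,
          EuclideanSpace.inner_single_right, EuclideanSpace.inner_single_right]
        simp
      rw [← hin]
      refine h _ ⟨(hin _).trans h0, fun i hi => ?_, fun i hi => ?_⟩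
      · exact add_nonneg (mul_nonneg hs ((hdir e).1 i hi)) (mul_nonneg ht ((hdir e').1 i hi))
      · exact add_nonpos (mul_nonpos_of_nonneg_of_nonpos hs ((hdir e).2 i hi))
          (mul_nonpos_of_nonneg_of_nonpos ht ((hdir e').2 i hi)))
  have hpos : ∀ i, i ∉ P.activeUpper x → 0 ≤ P.grad x i - ρ * P.q i := by
    intro i hi
    have := hρ ⟨(i, 1), Or.inl ⟨rfl, hi⟩⟩
    simp only [one_mul] at this
    linarith
  have hneg : ∀ i, i ∉ P.activeLower x → P.grad x i - ρ * P.q i ≤ 0 := by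
    intro i hi
    have := hρ ⟨(i, -1), Or.inr ⟨rfl, hi⟩⟩
    simp only at this
    linarith
  refine ⟨hx, ρ, fun i => P.grad x i - ρ * P.q i, fun i => by ring, fun i hi => ?_,
    fun i hi => hpos i (P.not_mem_activeUpper hi),
    fun i hi => hneg i fun hl => P.not_mem_activeUpper hl hi⟩
  exact le_antisymm (hneg i fun hl => hi (Or.inl hl)) (hpos i fun hu => hi (Or.inr hu))

theorem isStationary_of_feasible {x : EuclideanSpace ℝ (Fin n)} (hx : x ∈ P.feasible)
    (h : ∀ z ∈ P.feasible, 0 ≤ ⟪P.grad x, z - x⟫_ℝ) : P.IsStationary x := by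
  refine P.isStationary_of_tangent hx fun v hv => ?_
  obtain ⟨t, ht, hz⟩ := P.exists_add_smul_mem_feasible hx hv
  have := h _ hz
  rw [add_sub_cancel_left, real_inner_smul_right] at this
  exact (mul_nonneg_iff_of_pos_left ht).1 this

theorem isClosed_face (x : EuclideanSpace ℝ (Fin n)) : IsClosed (P.face x) := by
  have h : P.face x = {v | ⟪P.q, v⟫_ℝ = P.b} ∩
      ⋂ i ∈ P.active x, {v : EuclideanSpace ℝ (Fin n) | v i = x i} := by
    ext v; simp [face]
  rw [h]
  exact (isClosed_eq (by fun_prop) (by fun_prop)).inter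
    (isClosed_biInter fun i _ => isClosed_eq (by fun_prop) (by fun_prop))

end SLBQP

/-! ### Convergence of the method -/

namespace P2GPRun

variable {n : ℕ} {P : SLBQP n} {p : P2GPParams} (r : P2GPRun P p)

theorem mem_feasible (k : ℕ) : r.x k ∈ P.feasible := by
  induction k with
  | zero => exact r.x_zero
  | succ k ih =>
    cases hph : r.phase k with
    | identification =>
      obtain ⟨α, -, hα⟩ := r.identification_step k hph
      rw [hα]
      exact (P.isProj_arc ih α).1
    | minimization =>
      obtain ⟨d, -, ⟨-, ⟨α, hα, hx⟩, -⟩ | ⟨-, ⟨α, -, hx⟩, -⟩⟩ := r.minimization_step k hph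
      · rw [hx]
        exact hα.1.2
      · rw [hx]
        exact (isProj_proj (S := P.feasible ∩ P.face (r.x k)) ⟨r.x k, ih, ih.1, fun _ _ => rfl⟩
          (P.isClosed_feasible.inter (P.isClosed_face _)) _).1.1

theorem f_succ_le (k : ℕ) : P.f (r.x (k + 1)) ≤ P.f (r.x k) := by
  cases hph : r.phase k with
  | identification =>
    obtain ⟨α, hα, hx⟩ := r.identification_step k hph
    obtain ⟨a, ha, hle⟩ := P.exists_steplength_lower_bound p
    have hk := r.mem_feasible k
    have h := hα.sq_norm_le hk (ha.trans_le (hle _ hk _ hα))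
    rw [hx]
    have h0 := (mul_nonneg_iff_of_pos_left (div_pos p.γ₁_pos p.μ₁_mem.1)).1
      ((sq_nonneg _).trans h)
    linarith
  | minimization =>
    obtain ⟨d, ⟨-, -, hd⟩, ⟨hform, ⟨α, hα, hx⟩, -⟩ | ⟨-, -, hlt, -⟩⟩ := r.minimization_step k hph
    · have hα0 : 0 < α := hα.1.1
      have hsmul : P.form (α • d) (α • d) = α ^ 2 * P.form d d := by
        rw [P.form_eq_inner, P.form_eq_inner, map_smul, real_inner_smul_left,
          real_inner_smul_right]
        ring
      rw [hx, P.f_add, real_inner_smul_right, hsmul]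
      nlinarith [mul_nonpos_of_nonneg_of_nonpos hα0.le hd,
        mul_nonpos_of_nonneg_of_nonpos (sq_nonneg α) hform]
    · exact hlt.le

theorem antitone_f : Antitone fun k => P.f (r.x k) := antitone_nat_of_succ_le r.f_succ_le

/-- Successive iterates approach each other along the gradient projection iterations. -/
theorem tendsto_norm_sub (hb : BddBelow (Set.range fun k => P.f (r.x k))) :
    Tendsto (fun k => ‖r.x (k + 1) - r.x k‖) (atTop ⊓ 𝓟 r.gpIterations) (𝓝 0) := by
  have hf := tendsto_atTop_ciInf r.antitone_f hb
  have hdiff : Tendsto (fun k => p.γ₁ / p.μ₁ * (P.f (r.x k) - P.f (r.x (k + 1))))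
      (atTop ⊓ 𝓟 r.gpIterations) (𝓝 0) := by
    have := (hf.sub (hf.comp (tendsto_add_atTop_nat 1))).const_mul (p.γ₁ / p.μ₁)
    rw [sub_self, mul_zero] at this
    exact this.mono_left inf_le_left
  have hsq : Tendsto (fun k => ‖r.x (k + 1) - r.x k‖ ^ 2) (atTop ⊓ 𝓟 r.gpIterations) (𝓝 0) := by
    refine tendsto_of_tendsto_of_tendsto_of_le_of_le' tendsto_const_nhds hdiff
      (Eventually.of_forall fun k => sq_nonneg _) ?_
    filter_upwards [mem_inf_of_right (mem_principal_self _)] with k hk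
    obtain ⟨α, hα, hx⟩ := r.identification_step k hk
    obtain ⟨a, ha, hle⟩ := P.exists_steplength_lower_bound p
    have hkf := r.mem_feasible k
    rw [hx]
    exact hα.sq_norm_le hkf (ha.trans_le (hle _ hkf _ hα))
  simpa using hsq.sqrt

theorem tendsto_norm_projGrad (hb : BddBelow (Set.range fun k => P.f (r.x k))) :
    Tendsto (fun k => ‖P.projGrad (r.x (k + 1))‖) (atTop ⊓ 𝓟 r.gpIterations) (𝓝 0) := by
  obtain ⟨a, ha, hle⟩ := P.exists_steplength_lower_bound p
  have hlim := (r.tendsto_norm_sub hb).const_mul (a⁻¹ + ‖P.hessian‖)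
  rw [mul_zero] at hlim
  refine tendsto_of_tendsto_of_tendsto_of_le_of_le' tendsto_const_nhds hlim
    (Eventually.of_forall fun k => norm_nonneg _) ?_
  filter_upwards [mem_inf_of_right (mem_principal_self _)] with k hk
  obtain ⟨α, hα, hx⟩ := r.identification_step k hk
  have hkf := r.mem_feasible k
  rw [hx]
  exact P.norm_projGrad_arc_le hkf ha (hle _ hkf _ hα)

theorem bddBelow_of_isBounded {K : Set ℕ} (hK : K.Infinite)
    (hb : Bornology.IsBounded (r.x '' K)) : BddBelow (Set.range fun k => P.f (r.x k)) := by
  obtain ⟨c, hc⟩ := hb.isCompact_closure.bddBelow_image P.continuous_f.continuousOn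
  refine ⟨c, ?_⟩
  rintro _ ⟨k, rfl⟩
  obtain ⟨j, hj, hkj⟩ := hK.exists_gt k
  exact (hc ⟨_, subset_closure ⟨j, hj, rfl⟩, rfl⟩).trans (r.antitone_f hkj.le)

theorem isStationary_of_mapClusterPt {y : EuclideanSpace ℝ (Fin n)}
    (hy : MapClusterPt y (atTop ⊓ 𝓟 r.gpIterations) r.x) : P.IsStationary y := by
  set F := atTop ⊓ 𝓟 r.gpIterations with hF
  let G := F ⊓ comap r.x (𝓝 y)
  have : G.NeBot := by
    have h : (𝓝 y ⊓ map r.x F).NeBot := hy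
    rw [← map_neBot_iff r.x, Filter.push_pull, inf_comm]
    exact h
  have hx : Tendsto r.x G (𝓝 y) := tendsto_comap.mono_left inf_le_right
  have hGF : G ≤ F := inf_le_left
  have hGtop : G ≤ atTop := hGF.trans inf_le_left
  have hb : BddBelow (Set.range fun k => P.f (r.x k)) := by
    refine ⟨P.f y, ?_⟩
    rintro _ ⟨k, rfl⟩
    exact le_of_tendsto ((P.continuous_f.tendsto y).comp hx)
      (((eventually_ge_atTop k).filter_mono hGtop).mono fun j hj => r.antitone_f hj)
  have hd := (r.tendsto_norm_sub hb).mono_left hGF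
  have hx1 : Tendsto (fun k => r.x (k + 1)) G (𝓝 y) := by
    simpa using hx.add (tendsto_zero_iff_norm_tendsto_zero.2 hd)
  have hyf : y ∈ P.feasible :=
    P.isClosed_feasible.mem_of_tendsto hx (Eventually.of_forall r.mem_feasible)
  refine P.isStationary_of_feasible hyf fun z hz => ?_
  obtain ⟨a, ha, hle⟩ := P.exists_steplength_lower_bound p
  have hz1 : Tendsto (fun k => z - r.x (k + 1)) G (𝓝 (z - y)) := tendsto_const_nhds.sub hx1
  have hleft : Tendsto (fun k => -⟪P.grad (r.x k), z - r.x (k + 1)⟫_ℝ) G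
      (𝓝 (-⟪P.grad y, z - y⟫_ℝ)) :=
    (((P.continuous_grad.tendsto y).comp hx).inner hz1).neg
  have hright : Tendsto (fun k => a⁻¹ * (‖r.x (k + 1) - r.x k‖ * ‖z - r.x (k + 1)‖)) G (𝓝 0) := by
    simpa using (hd.mul hz1.norm).const_mul a⁻¹
  have hlim := le_of_tendsto_of_tendsto hleft hright (by
    filter_upwards [hGF (mem_inf_of_right (mem_principal_self _))] with k hk
    obtain ⟨α, hα, hxk⟩ := r.identification_step k hk
    have hkf := r.mem_feasible k
    have haα := hle _ hkf _ hα
    have hα0 := ha.trans_le haα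
    rw [hxk]
    calc _ ≤ _ := P.neg_inner_grad_le hkf hz hα0
      _ ≤ α⁻¹ * (‖P.arc (r.x k) α - r.x k‖ * ‖z - P.arc (r.x k) α‖) := by
        gcongr
        exact real_inner_le_norm _ _
      _ ≤ _ := by gcongr)
  linarith

end P2GPRun

theorem mainTheorem2 {n : ℕ} (P : SLBQP n) (p : P2GPParams) (r : P2GPRun P p)
    (hGP : r.gpIterations.Infinite) :
    (∀ K : Set ℕ, K ⊆ r.gpIterations → K.Infinite → Bornology.IsBounded (r.x '' K) →
      Tendsto (fun k => ‖P.projGrad (r.x (k + 1))‖) (atTop ⊓ 𝓟 K) (𝓝 0)) ∧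
    (∀ y : EuclideanSpace ℝ (Fin n),
      MapClusterPt y (atTop ⊓ 𝓟 r.gpIterations) r.x → P.IsStationary y) :=
  ⟨fun _ hK hinf hb => (r.tendsto_norm_projGrad (r.bddBelow_of_isBounded hinf hb)).mono_left
    (inf_le_inf_left _ (principal_mono.2 hK)), fun _ hy => r.isStationary_of_mapClusterPt hy⟩
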